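/- For a subset $K$ of a normed space $X$ and $n\ge 0$, let the entropy number $\varepsilon_n(K)_X$ be the infimum of all $\varepsilon>0$ for which $K$ can be covered by $2^n$ balls of $X$ of radius $\varepsilon$. Let $\ell_\infty(\Gamma)$ be the space of bounded real-valued functions on a set $\Gamma$ with the supremum norm, and $\ell_\infty^m$ the space $\mathbb{R}^m$ with the maximum norm. There is an absolute constant $C>0$ (not depending on $X$, $\Gamma$, $K$ or $n$) such that the following holds. Let $X$ be a real Banach space that is isometric to $\ell_\infty(\Gamma)$ for some set $\Gamma$, and let $K\subset X$ be compact. Then for each $n\ge 1$ there are mappings $$a_n:X\to \ell_\infty^{26n},\qquad M_n:\ell_\infty^{26n}\to X,$$ both Lipschitz with constant $Cn^{3/4}$, such that $$\sup_{f\in K}\|f-M_n(a_n(f))\|_X\le C\,n^{3/2}\,\varepsilon_n(K)_X .$$ -/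

import Mathlib

open scoped NNReal ENNReal

/-- The `n`-th entropy number of a subset `K` of a metric space `X`: the infimum of all `ε > 0` for
which `K` is covered by `2 ^ n` balls of radius `ε` (centres anywhere in `X`, repetitions allowed).
For bounded `K` the set of such `ε` is nonempty, so the real infimum is not a default value. -/
noncomputable def entropyNumber {X : Type*} [PseudoMetricSpace X] (n : ℕ) (K : Set X) : ℝ :=
  sInf {ε : ℝ | 0 < ε ∧ ∃ c : Fin (2 ^ n) → X, K ⊆ ⋃ i, Metric.closedBall (c i) ε}

/-!
Let `S` be a set of at most `2 ^ n` points that comes within `2 ε_n(K)` of every point of `K`. As in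
Bourgain's embedding theorem, consider the distances from a point to random sets at `n` dyadic
densities, with 32 independent sets per density, and add them up with random signs. This random
function is `32 n`-Lipschitz. At each scale the distances to some of the 32 sets probably differ, at
two given points `x, y` of `S`, by at least the increment of Bourgain's radii; these increments sum
to `dist x y / 2`, so by Cauchy–Schwarz their squares sum to at least `dist x y ^ 2 / (4 n)`, and by
the Paley–Zygmund inequality for the signs the function separates `x` from `y` by at least
`dist x y / (4 √n)` with probability at least `1 / 15`. Since `4 (14 / 15) ^ 26 < 1`, a union bound
over the at most `4 ^ n` pairs shows that some `26 n` such functions separate all pairs.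

Multiplying this embedding of `S` into `ℓ_∞^{26 n}` by `n ^ (-1 / 4)`, both it and its inverse have
Lipschitz constants of order `n ^ (3 / 4)`, and both extend to the whole spaces because `X` and
`ℓ_∞^{26 n}` are injective. The composition of the extensions is Lipschitz with constant of order
`n ^ (3 / 2)` and fixes `S`, so it moves points of `K` by at most order `n ^ (3 / 2) ε_n(K)`.
-/

section UniformProbability

open Finset
open scoped BigOperators

variable {Ω Ω' : Type*} [Fintype Ω] [Fintype Ω']

lemma dens_filter_eq_expect (p : Ω → Prop) [DecidablePred p] :
    (dens {ω | p ω} : ℝ) = 𝔼 ω, if p ω then 1 else 0 := by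
  rw [← expect_indicator_one]
  simp only [Set.indicator_apply, Finset.coe_filter_univ, Set.mem_ofPred_eq, Pi.one_apply]

lemma dens_filter_mono {p q : Ω → Prop} [DecidablePred p] [DecidablePred q]
    (h : ∀ ω, p ω → q ω) : (dens {ω | p ω} : ℝ) ≤ dens {ω | q ω} :=
  mod_cast dens_le_dens (monotone_filter_right univ fun ω _ => h ω)

lemma dens_filter_not [Nonempty Ω] (p : Ω → Prop) [DecidablePred p] :
    (dens {ω | ¬ p ω} : ℝ) = 1 - dens {ω | p ω} := by
  have h := dens_filter_add_dens_filter_not_eq_dens (s := (univ : Finset Ω)) p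
  rw [dens_univ] at h
  exact eq_sub_of_add_eq' (mod_cast h)

lemma dens_filter_forall {ι : Type*} [Fintype ι] [DecidableEq ι] (p : ι → Ω → Prop)
    [∀ i, DecidablePred (p i)] :
    (dens {ω : ι → Ω | ∀ i, p i (ω i)} : ℝ) = ∏ i, (dens {a | p i a} : ℝ) := by
  have hset : ({ω | ∀ i, p i (ω i)} : Finset (ι → Ω)) =
      Fintype.piFinset fun i => {a | p i a} := by
    ext ω
    simp
  simp [hset, nnratCast_dens, Fintype.card_piFinset, prod_div_distrib]

lemma dens_filter_not_exists [Nonempty Ω] {κ : Type*} [Fintype κ] [DecidableEq κ] (p : Ω → Prop)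
    [DecidablePred p] :
    (dens {ω : κ → Ω | ¬ ∃ k, p (ω k)} : ℝ) = (1 - dens {a | p a}) ^ Fintype.card κ := by
  simp only [not_exists]
  rw [dens_filter_forall fun (_ : κ) a => ¬ p a, prod_const, card_univ, dens_filter_not]

lemma dens_filter_prod (r : Ω → Ω' → Prop) [∀ ω, DecidablePred (r ω)] :
    (dens {x : Ω × Ω' | r x.1 x.2} : ℝ) = 𝔼 ω, (dens {ω' | r ω ω'} : ℝ) := by
  rw [dens_filter_eq_expect, ← univ_product_univ, expect_product]
  simp only [dens_filter_eq_expect]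

lemma mul_le_dens_filter_prod {p : Ω → Prop} {r : Ω → Ω' → Prop} [DecidablePred p]
    [∀ ω, DecidablePred (r ω)] {a b : ℝ} (ha : a ≤ dens {ω | p ω}) (hb : 0 ≤ b)
    (h : ∀ ω, p ω → b ≤ dens {ω' | r ω ω'}) :
    a * b ≤ dens {x : Ω × Ω' | r x.1 x.2} := by
  calc a * b ≤ (dens {ω | p ω} : ℝ) * b := by gcongr
    _ = 𝔼 ω, (if p ω then 1 else 0) * b := by rw [dens_filter_eq_expect, expect_mul]
    _ ≤ 𝔼 ω, (dens {ω' | r ω ω'} : ℝ) := expect_le_expect fun ω _ => by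
      split_ifs with hω
      · simpa only [one_mul] using h ω hω
      · rw [zero_mul]
        positivity
    _ = dens {x : Ω × Ω' | r x.1 x.2} := (dens_filter_prod r).symm

lemma mul_dens_filter_le_expect {f : Ω → ℝ} (hf : 0 ≤ f) (t : ℝ) :
    t * dens {ω | t ≤ f ω} ≤ 𝔼 ω, f ω := by
  rw [dens_filter_eq_expect, mul_expect]
  refine expect_le_expect fun ω _ => ?_
  split_ifs with hω
  · rwa [mul_one]
  · rw [mul_zero]
    exact hf ω

lemma paley_zygmund_dens {f : Ω → ℝ} (hf : 0 ≤ f) {θ : ℝ} (hθ₀ : 0 ≤ θ) (hθ₁ : θ ≤ 1) :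
    (1 - θ) ^ 2 * (𝔼 ω, f ω) ^ 2 ≤ dens {ω | θ * 𝔼 ω', f ω' ≤ f ω} * 𝔼 ω, f ω ^ 2 := by
  set m := 𝔼 ω, f ω with hm
  set g : Ω → ℝ := fun ω => if θ * m ≤ f ω then 1 else 0 with hg
  have hm₀ : 0 ≤ m := expect_nonneg fun ω _ => hf ω
  have hmean : m ≤ θ * m + 𝔼 ω, g ω * f ω := by
    rcases isEmpty_or_nonempty Ω with hΩ | hΩ
    · simp [hm]
    rw [← Fintype.expect_const (ι := Ω) (θ * m), ← expect_add_distrib]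
    refine expect_le_expect fun ω _ => ?_
    simp only [hg]
    split_ifs with hω
    · linarith [mul_nonneg hθ₀ hm₀]
    · linarith
  have hg_sq : ∀ ω, g ω ^ 2 = g ω := fun ω => by
    simp only [hg]
    split_ifs <;> norm_num
  calc (1 - θ) ^ 2 * m ^ 2 = ((1 - θ) * m) ^ 2 := (mul_pow _ _ _).symm
    _ ≤ (𝔼 ω, g ω * f ω) ^ 2 :=
      pow_le_pow_left₀ (mul_nonneg (sub_nonneg.2 hθ₁) hm₀) (by linarith) 2
    _ ≤ (𝔼 ω, g ω ^ 2) * 𝔼 ω, f ω ^ 2 := expect_mul_sq_le_sq_mul_sq univ g f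
    _ = dens {ω | θ * m ≤ f ω} * 𝔼 ω, f ω ^ 2 := by
      simp only [hg_sq]
      rw [dens_filter_eq_expect]

lemma one_sub_two_mul_le_dens_half_sum_le [Nonempty Ω] {κ : Type*} [Fintype κ] {w : κ → ℝ}
    (hw : 0 ≤ w) (hW : 0 < ∑ j, w j) {A : κ → Ω → Prop} [∀ j, DecidablePred (A j)] {η : ℝ}
    (hA : ∀ j, dens {ω | ¬ A j ω} ≤ η) :
    1 - 2 * η ≤ dens {ω | (∑ j, w j) / 2 ≤ ∑ j with A j ω, w j} := by
  set W := ∑ j, w j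
  set loss : Ω → ℝ := fun ω => ∑ j with ¬ A j ω, w j with hloss
  have hsplit : ∀ ω, ∑ j with A j ω, w j = W - loss ω := fun ω =>
    eq_sub_of_add_eq (sum_filter_add_sum_filter_not univ (A · ω) w)
  have hloss₀ : 0 ≤ loss := fun ω => sum_nonneg fun j _ => hw j
  have hmean : 𝔼 ω, loss ω ≤ η * W := by
    simp only [hloss, sum_filter]
    rw [expect_sum_comm, mul_sum]
    refine sum_le_sum fun j _ => ?_
    calc 𝔼 ω, (if ¬ A j ω then w j else 0) = dens {ω | ¬ A j ω} * w j := by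
          simp only [dens_filter_eq_expect, expect_mul, ite_mul, one_mul, zero_mul]
      _ ≤ η * w j := mul_le_mul_of_nonneg_right (hA j) (hw j)
  have hfail : (dens {ω | ¬ W / 2 ≤ ∑ j with A j ω, w j} : ℝ) ≤ 2 * η := by
    have hmarkov := mul_dens_filter_le_expect hloss₀ (W / 2)
    have hle : (dens {ω | ¬ W / 2 ≤ ∑ j with A j ω, w j} : ℝ) ≤ dens {ω | W / 2 ≤ loss ω} :=
      dens_filter_mono fun ω hω => by linarith [hsplit ω]
    refine hle.trans (le_of_mul_le_mul_left ?_ (half_pos hW))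
    linarith
  linarith [dens_filter_not fun ω => W / 2 ≤ ∑ j with A j ω, w j]

lemma exists_forall_exists_of_card_mul_pow_lt_one [Nonempty Ω] {κ Q : Type*} [Fintype κ]
    {s : Finset Q} {good : Q → Ω → Prop} [∀ q, DecidablePred (good q)] {p : ℝ}
    (hgood : ∀ q ∈ s, p ≤ dens {ω | good q ω}) (hs : #s * (1 - p) ^ Fintype.card κ < 1) :
    ∃ ω : κ → Ω, ∀ q ∈ s, ∃ k, good q (ω k) := by
  classical
  by_contra! hbad
  have hcover : (univ : Finset (κ → Ω)) ⊆ s.biUnion fun q => {ω | ¬ ∃ k, good q (ω k)} :=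
    fun ω _ => by simpa using hbad ω
  have hfail : ∀ q ∈ s, (dens {ω : κ → Ω | ¬ ∃ k, good q (ω k)} : ℝ) ≤ (1 - p) ^ Fintype.card κ :=
    fun q hq => by
      rw [dens_filter_not_exists]
      have : (dens {ω | good q ω} : ℝ) ≤ 1 := mod_cast dens_le_one
      exact pow_le_pow_left₀ (by linarith) (by linarith [hgood q hq]) _
  have hsum := (dens_le_dens hcover).trans dens_biUnion_le
  rw [dens_univ] at hsum
  refine hs.not_ge ?_
  calc (1 : ℝ) ≤ ∑ q ∈ s, (dens {ω : κ → Ω | ¬ ∃ k, good q (ω k)} : ℝ) := mod_cast hsum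
    _ ≤ ∑ _q ∈ s, (1 - p) ^ Fintype.card κ := sum_le_sum hfail
    _ = #s * (1 - p) ^ Fintype.card κ := by rw [sum_const, nsmul_eq_mul]

end UniformProbability

section RademacherSums

open Finset
open scoped BigOperators

variable {ι : Type*} [DecidableEq ι]

lemma sq_sign_smul_add (u : ℤˣ) (a z : ℝ) :
    (u • a + z) ^ 2 = a ^ 2 + z ^ 2 + u • (2 * a * z) := by
  rcases Int.units_eq_one_or u with rfl | rfl <;> simp only [one_smul, Units.neg_smul] <;> ring

lemma pow_four_sign_smul_add (u : ℤˣ) (a z : ℝ) :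
    (u • a + z) ^ 4 =
      a ^ 4 + 6 * a ^ 2 * z ^ 2 + z ^ 4 + u • (4 * a ^ 3 * z + 4 * a * z ^ 3) := by
  rcases Int.units_eq_one_or u with rfl | rfl <;> simp only [one_smul, Units.neg_smul] <;> ring

lemma sum_sign_smul_flip {s : Finset ι} {i : ι} (hi : i ∉ s) (t : ι → ℝ) (ε : ι → ℤˣ) :
    ∑ j ∈ s, (ε * Pi.mulSingle i (-1) : ι → ℤˣ) j • t j = ∑ j ∈ s, ε j • t j := by
  refine sum_congr rfl fun j hj => ?_
  rw [Pi.mul_apply, Pi.mulSingle_eq_of_ne (ne_of_mem_of_not_mem hj hi), mul_one]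

variable [Fintype ι]

lemma expect_sign_smul_eq_zero (i : ι) {g : (ι → ℤˣ) → ℝ}
    (hg : ∀ ε, g (ε * Pi.mulSingle i (-1)) = g ε) : 𝔼 ε : ι → ℤˣ, ε i • g ε = 0 := by
  have hflip : 𝔼 ε : ι → ℤˣ, ε i • g ε = 𝔼 ε : ι → ℤˣ, -(ε i • g ε) :=
    (Fintype.expect_equiv (Equiv.mulRight (Pi.mulSingle i (-1))) _ _ fun ε => by simp [hg]).symm
  rw [expect_neg_distrib] at hflip
  linarith

lemma expect_sum_sign_smul_sq (s : Finset ι) (t : ι → ℝ) :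
    𝔼 ε : ι → ℤˣ, (∑ i ∈ s, ε i • t i) ^ 2 = ∑ i ∈ s, t i ^ 2 := by
  induction s using Finset.induction_on with
  | empty => simp
  | insert i s hi ih =>
    simp only [sum_insert hi, sq_sign_smul_add, expect_add_distrib, Fintype.expect_const, ih]
    rw [expect_sign_smul_eq_zero i fun ε => by rw [sum_sign_smul_flip hi], add_zero]

lemma expect_sum_sign_smul_pow_four_le (s : Finset ι) (t : ι → ℝ) :
    𝔼 ε : ι → ℤˣ, (∑ i ∈ s, ε i • t i) ^ 4 ≤ 3 * (∑ i ∈ s, t i ^ 2) ^ 2 := by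
  induction s using Finset.induction_on with
  | empty => simp
  | insert i s hi ih =>
    simp only [sum_insert hi, pow_four_sign_smul_add, expect_add_distrib, Fintype.expect_const,
      ← mul_expect, expect_sum_sign_smul_sq]
    rw [expect_sign_smul_eq_zero i fun ε => by rw [sum_sign_smul_flip hi], add_zero]
    linarith [pow_nonneg (sq_nonneg (t i)) 2]

lemma one_div_twelve_le_dens_sum_sign_smul_sq_ge (t : ι → ℝ) :
    (1 / 12 : ℝ) ≤ dens {ε : ι → ℤˣ | (∑ i, t i ^ 2) / 2 ≤ (∑ i, ε i • t i) ^ 2} := by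
  have hpz := paley_zygmund_dens (f := fun ε : ι → ℤˣ => (∑ i, ε i • t i) ^ 2)
    (fun ε => sq_nonneg _) (θ := 1 / 2) (by norm_num) (by norm_num)
  have hfour : 𝔼 ε : ι → ℤˣ, ((∑ i, ε i • t i) ^ 2) ^ 2 ≤ 3 * (∑ i, t i ^ 2) ^ 2 := by
    simpa only [← pow_mul] using expect_sum_sign_smul_pow_four_le univ t
  simp only [expect_sum_sign_smul_sq, one_div_mul_eq_div] at hpz
  set V := ∑ i, t i ^ 2
  have hV₀ : 0 ≤ V := sum_nonneg fun i _ => sq_nonneg (t i)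
  rcases hV₀.eq_or_lt with hV | hV
  · simp only [← hV, zero_div, sq_nonneg, filter_true, dens_univ]
    norm_num
  · refine le_of_mul_le_mul_right ?_ (by positivity : 0 < 3 * V ^ 2)
    calc 1 / 12 * (3 * V ^ 2) = (1 - 1 / 2) ^ 2 * V ^ 2 := by ring
      _ ≤ _ := hpz
      _ ≤ _ := by gcongr

end RademacherSums

section RandomSubsets

open Finset

variable {P Λ : Type*} [Fintype P] [DecidableEq P] [Fintype Λ] [Nonempty Λ]

lemma dens_filter_forall_mem_not (p : Λ → Prop) [DecidablePred p] (S : Finset P) :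
    (dens {ω : P → Λ | ∀ z ∈ S, ¬ p (ω z)} : ℝ) = (1 - dens {v | p v}) ^ #S := by
  calc (dens {ω : P → Λ | ∀ z ∈ S, ¬ p (ω z)} : ℝ)
    _ = ∏ z, (dens {v | z ∈ S → ¬ p v} : ℝ) := dens_filter_forall fun z v => z ∈ S → ¬ p v
    _ = ∏ z, if z ∈ S then (dens {v | ¬ p v} : ℝ) else 1 := prod_congr rfl fun z _ => by
      by_cases hz : z ∈ S <;> simp [hz]
    _ = (1 - dens {v | p v}) ^ #S := by
      rw [Fintype.prod_ite_mem, prod_const, dens_filter_not]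

lemma dens_filter_miss_and_hit (p : Λ → Prop) [DecidablePred p] {S T : Finset P}
    (hST : Disjoint S T) :
    (dens {ω : P → Λ | (∀ z ∈ S, ¬ p (ω z)) ∧ ∃ z ∈ T, p (ω z)} : ℝ) =
      (1 - dens {v | p v}) ^ #S * (1 - (1 - dens {v | p v}) ^ #T) := by
  have hsplit := dens_filter_add_dens_filter_not_eq_dens
    (s := ({ω : P → Λ | ∀ z ∈ S, ¬ p (ω z)} : Finset _)) fun ω => ∃ z ∈ T, p (ω z)
  have hmiss : ∀ ω : P → Λ, ((∀ z ∈ S, ¬ p (ω z)) ∧ ¬ ∃ z ∈ T, p (ω z)) ↔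
      ∀ z ∈ S ∪ T, ¬ p (ω z) := fun ω => by
    simp only [not_exists, not_and, mem_union, or_imp, forall_and]
  simp only [filter_filter, hmiss] at hsplit
  have hsplit_real := congrArg (NNRat.cast (K := ℝ)) hsplit
  rw [NNRat.cast_add] at hsplit_real
  rw [eq_sub_of_add_eq hsplit_real, dens_filter_forall_mem_not, dens_filter_forall_mem_not,
    card_union_of_disjoint hST]
  ring

lemma one_div_twelve_le_pow_mul_one_sub_pow {k s t : ℕ} (hs : s ≤ 2 * k) (ht : k ≤ t)
    {q : ℝ} (hq : k * q = 1 / 2) :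
    1 / 12 ≤ (1 - q) ^ s * (1 - (1 - q) ^ t) := by
  have hk₀ : k ≠ 0 := by
    rintro rfl
    norm_num at hq
  have hk : (1 : ℝ) ≤ k := mod_cast Nat.one_le_iff_ne_zero.2 hk₀
  have hq₀ : 0 ≤ q := by
    by_contra! h
    nlinarith
  have hq₁ : q ≤ 1 / 2 := by nlinarith
  have hpow_ge : 1 / 2 ≤ (1 - q) ^ k := by
    have := one_add_mul_le_pow (a := -q) (by linarith) k
    rw [← sub_eq_add_neg] at this
    linarith
  have hpow_le : (1 - q) ^ k ≤ 2 / 3 := by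
    have hbern := one_add_mul_le_pow (a := q) (by linarith) k
    have hprod : (1 - q) ^ k * (1 + q) ^ k ≤ 1 := by
      rw [← mul_pow]
      exact pow_le_one₀ (by nlinarith) (by nlinarith)
    nlinarith
  have hs' : 1 / 4 ≤ (1 - q) ^ s :=
    calc (1 / 4 : ℝ) ≤ ((1 - q) ^ k) ^ 2 := by nlinarith
      _ = (1 - q) ^ (2 * k) := by rw [← pow_mul, mul_comm]
      _ ≤ (1 - q) ^ s := pow_le_pow_of_le_one (by linarith) (by linarith) hs
  have ht' : (1 - q) ^ t ≤ 2 / 3 :=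
    (pow_le_pow_of_le_one (by linarith) (by linarith) ht).trans hpow_le
  nlinarith

lemma dens_fin_val_lt_two_pow {n j : ℕ} (hj : j < n) :
    (dens {v : Fin (2 ^ n) | (v : ℕ) < 2 ^ (n - (j + 1))} : ℝ) = 1 / 2 ^ (j + 1) := by
  have hle : 2 ^ (n - (j + 1)) ≤ 2 ^ n := Nat.pow_le_pow_right two_pos (Nat.sub_le _ _)
  rw [nnratCast_dens, Fin.card_filter_val_lt, min_eq_right hle, Fintype.card_fin]
  push_cast
  rw [div_eq_div_iff (by positivity) (by positivity), one_mul, ← pow_add, Nat.sub_add_cancel hj]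

lemma one_div_twelve_le_dens_miss_and_hit {n j : ℕ} (hj : j < n) {S T : Finset P}
    (hST : Disjoint S T) (hS : #S ≤ 2 ^ (j + 1)) (hT : 2 ^ j ≤ #T) :
    (1 / 12 : ℝ) ≤ dens {ω : P → Fin (2 ^ n) |
      (∀ z ∈ S, ¬ (ω z : ℕ) < 2 ^ (n - (j + 1))) ∧ ∃ z ∈ T, (ω z : ℕ) < 2 ^ (n - (j + 1))} := by
  rw [dens_filter_miss_and_hit (fun v : Fin (2 ^ n) => (v : ℕ) < 2 ^ (n - (j + 1))) hST,
    dens_fin_val_lt_two_pow hj]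
  refine one_div_twelve_le_pow_mul_one_sub_pow (by rwa [← pow_succ']) hT ?_
  push_cast
  rw [pow_succ]
  field_simp

end RandomSubsets

section CriticalRadius

open Finset Filter
open scoped Topology

variable {P : Type*} [Fintype P] [PseudoMetricSpace P] {x y : P} {j n : ℕ}

/-- Bourgain's radius for the pair `x, y` at scale `j`: the least radius at which the closed balls
around both points contain at least `2 ^ j` points, capped at half the distance. -/
noncomputable def criticalRadius (x y : P) (j : ℕ) : ℝ :=
  sInf (insert (dist x y / 2)
    {ρ | 2 ^ j ≤ #{z | dist x z ≤ ρ} ∧ 2 ^ j ≤ #{z | dist y z ≤ ρ}})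

lemma nonneg_of_two_pow_le_card_closedBall {ρ : ℝ} (h : 2 ^ j ≤ #{z | dist x z ≤ ρ}) :
    0 ≤ ρ := by
  obtain ⟨z, hz⟩ := card_pos.1 ((Nat.two_pow_pos j).trans_le h)
  exact dist_nonneg.trans (mem_filter.1 hz).2

lemma bddBelow_criticalRadius_set : BddBelow (insert (dist x y / 2)
    {ρ | 2 ^ j ≤ #{z | dist x z ≤ ρ} ∧ 2 ^ j ≤ #{z | dist y z ≤ ρ}}) :=
  BddBelow.insert _ ⟨0, fun _ hρ => nonneg_of_two_pow_le_card_closedBall hρ.1⟩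

lemma criticalRadius_le_half_dist (x y : P) (j : ℕ) : criticalRadius x y j ≤ dist x y / 2 :=
  csInf_le bddBelow_criticalRadius_set (Set.mem_insert _ _)

lemma criticalRadius_le {ρ : ℝ} (hx : 2 ^ j ≤ #{z | dist x z ≤ ρ})
    (hy : 2 ^ j ≤ #{z | dist y z ≤ ρ}) : criticalRadius x y j ≤ ρ :=
  csInf_le bddBelow_criticalRadius_set (Set.mem_insert_of_mem _ ⟨hx, hy⟩)

lemma monotone_criticalRadius (x y : P) : Monotone (criticalRadius x y) := fun i j hij => by
  have hpow : 2 ^ i ≤ 2 ^ j := Nat.pow_le_pow_right two_pos hij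
  exact csInf_le_csInf bddBelow_criticalRadius_set (Set.insert_nonempty _ _)
    (Set.insert_subset_insert fun ρ hρ => ⟨hpow.trans hρ.1, hpow.trans hρ.2⟩)

lemma isClosed_setOf_le_card_closedBall (x : P) (k : ℕ) :
    IsClosed {ρ : ℝ | k ≤ #{z | dist x z ≤ ρ}} := by
  classical
  have hset : {ρ : ℝ | k ≤ #{z | dist x z ≤ ρ}} =
      ⋃ s ∈ ({s | k ≤ #s} : Finset (Finset P)), ⋂ z ∈ s, Set.Ici (dist x z) := by
    ext ρ
    simp only [Set.mem_ofPred_eq, mem_filter_univ, Set.mem_iUnion, Set.mem_iInter, Set.mem_Ici,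
      exists_prop]
    refine ⟨fun h => ⟨_, h, fun z hz => (mem_filter.1 hz).2⟩, fun ⟨s, hs, hsρ⟩ => hs.trans ?_⟩
    exact card_le_card fun z hz => mem_filter.2 ⟨mem_univ z, hsρ z hz⟩
  rw [hset]
  exact isClosed_biUnion_finset fun s _ => isClosed_biInter fun z _ => isClosed_Ici

lemma two_pow_le_card_closedBall_criticalRadius (h : criticalRadius x y j < dist x y / 2) :
    2 ^ j ≤ #{z | dist x z ≤ criticalRadius x y j} ∧
      2 ^ j ≤ #{z | dist y z ≤ criticalRadius x y j} := by
  have hclosed := isClosed_singleton (x := dist x y / 2) |>.union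
    ((isClosed_setOf_le_card_closedBall x (2 ^ j)).inter
      (isClosed_setOf_le_card_closedBall y (2 ^ j)))
  exact (hclosed.csInf_mem (Set.insert_nonempty _ _) bddBelow_criticalRadius_set).resolve_left h.ne

lemma criticalRadius_zero (x y : P) : criticalRadius x y 0 = 0 := by
  refine le_antisymm (criticalRadius_le ?_ ?_) (le_csInf (Set.insert_nonempty _ _) ?_)
  · exact card_pos.2 ⟨x, by simp⟩
  · exact card_pos.2 ⟨y, by simp⟩
  · rintro ρ (rfl | hρ)
    · positivity
    · exact nonneg_of_two_pow_le_card_closedBall hρ.1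

lemma criticalRadius_eq_half_dist (hP : Fintype.card P ≤ 2 ^ n) :
    criticalRadius x y n = dist x y / 2 := by
  refine (criticalRadius_le_half_dist x y n).eq_of_not_lt fun hlt => ?_
  have hcard : #{z | dist x z ≤ criticalRadius x y n} = #(univ : Finset P) :=
    (card_le_univ _).antisymm (hP.trans (two_pow_le_card_closedBall_criticalRadius hlt).1)
  have hy : dist x y ≤ criticalRadius x y n := card_filter_eq_iff.1 hcard y (mem_univ y)
  linarith [dist_nonneg (x := x) (y := y)]

lemma eventually_card_ball_le_card_closedBall (x : P) (r : ℝ) :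
    ∀ᶠ ρ in 𝓝[<] r, #{z | dist x z < r} ≤ #{z | dist x z ≤ ρ} := by
  have h : ∀ᶠ ρ in 𝓝[<] r, ∀ z, dist x z < r → dist x z ≤ ρ := by
    refine eventually_all.2 fun z => ?_
    by_cases hz : dist x z < r
    · filter_upwards [Ioo_mem_nhdsLT hz] with ρ hρ _ using hρ.1.le
    · exact .of_forall fun ρ h => absurd h hz
  filter_upwards [h] with ρ hρ
  exact card_le_card (monotone_filter_right _ fun z _ => hρ z)

lemma card_ball_criticalRadius_lt (x y : P) (j : ℕ) :
    #{z | dist x z < criticalRadius x y j} < 2 ^ j ∨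
      #{z | dist y z < criticalRadius x y j} < 2 ^ j := by
  by_contra! h
  obtain ⟨ρ, hx, hy, hρ⟩ := ((eventually_card_ball_le_card_closedBall x _).and
    ((eventually_card_ball_le_card_closedBall y _).and self_mem_nhdsWithin)).exists
  exact (criticalRadius_le (h.1.trans hx) (h.2.trans hy)).not_gt hρ

end CriticalRadius

section RandomEmbedding

open Finset

lemma sum_filter_exists_le_abs_sq_le {ι κ : Type*} [Fintype ι] [Fintype κ] {g : ι → ℝ}
    (hg : 0 ≤ g) (f : ι → κ → ℝ) :
    ∑ j with ∃ b, g j ≤ |f j b|, g j ^ 2 ≤ ∑ i : ι × κ, f i.1 i.2 ^ 2 := by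
  have hterm : ∀ j, (∃ b, g j ≤ |f j b|) → g j ^ 2 ≤ ∑ b, f j b ^ 2 := by
    rintro j ⟨b, hb⟩
    calc g j ^ 2 ≤ |f j b| ^ 2 := pow_le_pow_left₀ (hg j) hb 2
      _ = f j b ^ 2 := sq_abs _
      _ ≤ ∑ b, f j b ^ 2 :=
        single_le_sum (f := fun b => f j b ^ 2) (fun _ _ => sq_nonneg _) (mem_univ b)
  rw [Fintype.sum_prod_type]
  exact (sum_le_sum fun j hj => hterm j (mem_filter.1 hj).2).trans
    (sum_le_sum_of_subset_of_nonneg (filter_subset _ _) fun _ _ _ =>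
      sum_nonneg fun _ _ => sq_nonneg _)

/-- The subset of `P` selected at scale `j` by a labelling `ω`: for a uniformly random `ω` it
contains each point independently with probability `2 ^ (-(j + 1))`. Using one labelling for all
scales makes these subsets nested, which is harmless. -/
def labelSet {P : Type*} {n : ℕ} (ω : P → Fin (2 ^ n)) (j : ℕ) : Set P :=
  {z | (ω z : ℕ) < 2 ^ (n - (j + 1))}

variable {P κ : Type*} [PseudoMetricSpace P] [Fintype κ]

lemma sub_le_infDist_sub_infDist {A : Set P} {x y : P} {r s : ℝ}
    (hx : ∀ z, dist x z < s → z ∉ A) (hy : ∃ z ∈ A, dist y z ≤ r) :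
    s - r ≤ Metric.infDist x A - Metric.infDist y A := by
  obtain ⟨z, hzA, hz⟩ := hy
  have hfar : s ≤ Metric.infDist x A :=
    (Metric.le_infDist ⟨z, hzA⟩).2 fun {w} hw => not_lt.1 fun h => hx w h hw
  have hnear : Metric.infDist y A ≤ r := (Metric.infDist_le_dist_of_mem hzA).trans hz
  linarith

/-- The difference of the distances of `x` and `y` to the set selected at scale `j` by `ω`. -/
noncomputable def labelDistDiff {n : ℕ} (ω : P → Fin (2 ^ n)) (x y : P) (j : ℕ) : ℝ :=
  Metric.infDist x (labelSet ω j) - Metric.infDist y (labelSet ω j)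

lemma labelDistDiff_comm {n : ℕ} (ω : P → Fin (2 ^ n)) (x y : P) (j : ℕ) :
    labelDistDiff ω x y j = -labelDistDiff ω y x j :=
  (neg_sub _ _).symm

/-- The random coordinate determined by the labellings `ω` and the signs `ε`: the signed sum of the
distances to all the selected sets. -/
noncomputable def randomCoord {n : ℕ} (ω : κ → P → Fin (2 ^ n)) (ε : Fin n × κ → ℤˣ)
    (x : P) : ℝ :=
  ∑ i, ε i • Metric.infDist x (labelSet (ω i.2) i.1)

lemma randomCoord_sub {n : ℕ} (ω : κ → P → Fin (2 ^ n)) (ε : Fin n × κ → ℤˣ)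
    (x y : P) : randomCoord ω ε x - randomCoord ω ε y =
      ∑ i, ε i • labelDistDiff (ω i.2) x y i.1 := by
  simp only [randomCoord, labelDistDiff, smul_sub, sum_sub_distrib]

lemma lipschitzWith_randomCoord {n : ℕ} (ω : κ → P → Fin (2 ^ n))
    (ε : Fin n × κ → ℤˣ) : LipschitzWith (n * Fintype.card κ) (randomCoord ω ε) := by
  refine LipschitzWith.of_dist_le_mul fun x y => ?_
  have hterm : ∀ i, dist (ε i • Metric.infDist x (labelSet (ω i.2) i.1))
      (ε i • Metric.infDist y (labelSet (ω i.2) i.1)) ≤ dist x y := fun i => by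
    rw [dist_eq_norm, ← smul_sub, norm_units_zsmul, ← dist_eq_norm]
    simpa only [NNReal.coe_one, one_mul] using
      (Metric.lipschitz_infDist_pt (labelSet (ω i.2) i.1)).dist_le_mul x y
  refine (dist_sum_sum_le_of_le univ fun i _ => hterm i).trans_eq ?_
  simp [mul_assoc]

variable [Fintype P] {x y : P} {n : ℕ}

lemma dist_sq_div_le_sum_criticalRadius_gap_sq (hn : 1 ≤ n) (hP : Fintype.card P ≤ 2 ^ n)
    (x y : P) : dist x y ^ 2 / (4 * n) ≤
      ∑ j : Fin n, (criticalRadius x y (j + 1) - criticalRadius x y j) ^ 2 := by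
  have hsum : ∑ j : Fin n, (criticalRadius x y (j + 1) - criticalRadius x y j) = dist x y / 2 := by
    rw [Fin.sum_univ_eq_sum_range fun j => criticalRadius x y (j + 1) - criticalRadius x y j,
      sum_range_sub, criticalRadius_zero, criticalRadius_eq_half_dist hP, sub_zero]
  have hcs := sq_sum_le_card_mul_sum_sq (s := (univ : Finset (Fin n)))
    (f := fun j => criticalRadius x y (j + 1) - criticalRadius x y j)
  rw [hsum, card_univ, Fintype.card_fin] at hcs
  rw [div_le_iff₀ (by positivity)]
  linarith

variable [DecidableEq P] [DecidableEq κ]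

lemma one_div_twelve_le_dens_sub_le_infDist {j : ℕ} (hj : j < n) {r s : ℝ}
    (hrs : r + s ≤ dist x y) (hs : #{z | dist x z < s} < 2 ^ (j + 1))
    (hr : 2 ^ j ≤ #{z | dist y z ≤ r}) :
    (1 / 12 : ℝ) ≤ dens {ω : P → Fin (2 ^ n) | s - r ≤ |labelDistDiff ω x y j|} := by
  have hdisj : Disjoint (univ.filter (dist x · < s)) (univ.filter (dist y · ≤ r)) :=
    disjoint_filter.2 fun z _ hxz hyz => by linarith [dist_triangle_right x y z]
  refine (one_div_twelve_le_dens_miss_and_hit hj hdisj hs.le hr).trans (dens_filter_mono ?_)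
  rintro ω ⟨hmiss, z, hz, hzω⟩
  exact (sub_le_infDist_sub_infDist (fun w hw => hmiss w (mem_filter.2 ⟨mem_univ w, hw⟩))
    ⟨z, hzω, (mem_filter.1 hz).2⟩).trans (le_abs_self _)

lemma one_div_twelve_le_dens_criticalRadius_sub_le {j : ℕ} (hj : j < n) (x y : P) :
    (1 / 12 : ℝ) ≤ dens {ω : P → Fin (2 ^ n) |
      criticalRadius x y (j + 1) - criticalRadius x y j ≤ |labelDistDiff ω x y j|} := by
  have hle_succ := criticalRadius_le_half_dist x y (j + 1)
  rcases (criticalRadius_le_half_dist x y j).eq_or_lt with heq | hlt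
  · have hall : ∀ ω : P → Fin (2 ^ n), criticalRadius x y (j + 1) - criticalRadius x y j ≤
        |labelDistDiff ω x y j| := fun ω =>
      (by linarith : _ ≤ (0 : ℝ)).trans (abs_nonneg _)
    simp only [hall, filter_true, dens_univ]
    norm_num
  · have hballs := two_pow_le_card_closedBall_criticalRadius hlt
    have hrs : criticalRadius x y j + criticalRadius x y (j + 1) ≤ dist x y := by linarith
    rcases card_ball_criticalRadius_lt x y (j + 1) with hx | hy
    · exact one_div_twelve_le_dens_sub_le_infDist hj hrs hx hballs.2
    · simpa only [labelDistDiff_comm _ y x, abs_neg] using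
        one_div_twelve_le_dens_sub_le_infDist hj (dist_comm x y ▸ hrs) hy hballs.1

lemma dens_not_exists_criticalRadius_gap_le (hκ : 32 ≤ Fintype.card κ) (j : Fin n) (x y : P) :
    (dens {ω : κ → P → Fin (2 ^ n) | ¬ ∃ b, criticalRadius x y (j + 1) - criticalRadius x y j ≤
      |labelDistDiff (ω b) x y j|} : ℝ) ≤ 1 / 10 := by
  rw [dens_filter_not_exists fun ω : P → Fin (2 ^ n) =>
    criticalRadius x y (j + 1) - criticalRadius x y j ≤ |labelDistDiff ω x y j|]
  have hscale := one_div_twelve_le_dens_criticalRadius_sub_le j.2 x y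
  calc _ ≤ (11 / 12 : ℝ) ^ Fintype.card κ :=
        pow_le_pow_left₀ (sub_nonneg.2 (mod_cast dens_le_one)) (by linarith) _
    _ ≤ (11 / 12 : ℝ) ^ 32 := pow_le_pow_of_le_one (by norm_num) (by norm_num) hκ
    _ ≤ 1 / 10 := by norm_num

lemma four_fifths_le_dens_sum_labelDistDiff_sq (hn : 1 ≤ n) (hP : Fintype.card P ≤ 2 ^ n)
    (hκ : 32 ≤ Fintype.card κ) (hxy : 0 < dist x y) :
    (4 / 5 : ℝ) ≤ dens {ω : κ → P → Fin (2 ^ n) | dist x y ^ 2 / (8 * n) ≤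
      ∑ i : Fin n × κ, labelDistDiff (ω i.2) x y i.1 ^ 2} := by
  set gap : Fin n → ℝ := fun j => criticalRadius x y (j + 1) - criticalRadius x y j
  have hgap₀ : 0 ≤ gap := fun j => sub_nonneg.2 (monotone_criticalRadius x y (Nat.le_succ _))
  have hgap_sq : dist x y ^ 2 / (4 * n) ≤ ∑ j, gap j ^ 2 :=
    dist_sq_div_le_sum_criticalRadius_gap_sq hn hP x y
  have hmost : 1 - 2 * (1 / 10) ≤ (dens {ω : κ → P → Fin (2 ^ n) | (∑ j, gap j ^ 2) / 2 ≤
      ∑ j with ∃ b, gap j ≤ |labelDistDiff (ω b) x y j|, gap j ^ 2} : ℝ) :=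
    one_sub_two_mul_le_dens_half_sum_le (fun j => sq_nonneg (gap j))
      (lt_of_lt_of_le (by positivity) hgap_sq)
      fun j => dens_not_exists_criticalRadius_gap_le hκ j x y
  refine (by norm_num : (4 / 5 : ℝ) ≤ 1 - 2 * (1 / 10)).trans
    (hmost.trans (dens_filter_mono fun ω hω => ?_))
  calc dist x y ^ 2 / (8 * n) = dist x y ^ 2 / (4 * n) / 2 := by ring
    _ ≤ (∑ j, gap j ^ 2) / 2 := by gcongr
    _ ≤ ∑ j with ∃ b, gap j ≤ |labelDistDiff (ω b) x y j|, gap j ^ 2 := hω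
    _ ≤ ∑ i : Fin n × κ, labelDistDiff (ω i.2) x y i.1 ^ 2 :=
      sum_filter_exists_le_abs_sq_le hgap₀ fun (j : Fin n) b => labelDistDiff (ω b) x y j

lemma one_div_fifteen_le_dens_randomCoord_sub_sq (hn : 1 ≤ n) (hP : Fintype.card P ≤ 2 ^ n)
    (hκ : 32 ≤ Fintype.card κ) (hxy : 0 < dist x y) :
    (1 / 15 : ℝ) ≤ dens {p : (κ → P → Fin (2 ^ n)) × (Fin n × κ → ℤˣ) |
      dist x y ^ 2 / (16 * n) ≤ (randomCoord p.1 p.2 x - randomCoord p.1 p.2 y) ^ 2} := by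
  have hsigns : ∀ ω : κ → P → Fin (2 ^ n),
      dist x y ^ 2 / (8 * n) ≤ ∑ i : Fin n × κ, labelDistDiff (ω i.2) x y i.1 ^ 2 →
      (1 / 12 : ℝ) ≤ dens {ε : Fin n × κ → ℤˣ |
        dist x y ^ 2 / (16 * n) ≤ (randomCoord ω ε x - randomCoord ω ε y) ^ 2} := fun ω hω => by
    refine (one_div_twelve_le_dens_sum_sign_smul_sq_ge fun i : Fin n × κ =>
      labelDistDiff (ω i.2) x y i.1).trans (dens_filter_mono fun ε hε => ?_)
    rw [randomCoord_sub]
    calc dist x y ^ 2 / (16 * n) = dist x y ^ 2 / (8 * n) / 2 := by ring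
      _ ≤ (∑ i : Fin n × κ, labelDistDiff (ω i.2) x y i.1 ^ 2) / 2 := by gcongr
      _ ≤ (∑ i, ε i • labelDistDiff (ω i.2) x y i.1) ^ 2 := hε
  have hprod := mul_le_dens_filter_prod (four_fifths_le_dens_sum_labelDistDiff_sq hn hP hκ hxy)
    (by norm_num) hsigns
  exact (by norm_num : (1 / 15 : ℝ) = 4 / 5 * (1 / 12)).trans_le hprod

end RandomEmbedding

section Embedding

open Finset

variable {P : Type*} [PseudoMetricSpace P] [Fintype P] {n : ℕ}

lemma card_pairs_mul_pow_lt_one (hn : 1 ≤ n) (hP : Fintype.card P ≤ 2 ^ n) :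
    (#{q : P × P | 0 < dist q.1 q.2} : ℝ) * (1 - 1 / 15) ^ (26 * n) < 1 := by
  have hpairs : #{q : P × P | 0 < dist q.1 q.2} ≤ 4 ^ n := by
    calc _ ≤ Fintype.card (P × P) := card_le_univ _
      _ ≤ 2 ^ n * 2 ^ n := by rw [Fintype.card_prod]; gcongr
      _ = 4 ^ n := by rw [← mul_pow]; norm_num
  calc _ ≤ (4 : ℝ) ^ n * (1 - 1 / 15) ^ (26 * n) :=
        mul_le_mul_of_nonneg_right (mod_cast hpairs) (by norm_num)
    _ = (4 * (1 - 1 / 15) ^ 26) ^ n := by rw [mul_pow, ← pow_mul]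
    _ < 1 := pow_lt_one₀ (by norm_num) (by norm_num) (by lia)

lemma exists_lipschitzWith_antilipschitzWith_sqrt (hn : 1 ≤ n) (hP : Fintype.card P ≤ 2 ^ n) :
    ∃ F : P → Fin (26 * n) → ℝ,
      LipschitzWith (32 * n) F ∧ AntilipschitzWith (4 * NNReal.sqrt n) F := by
  classical
  obtain ⟨p, hp⟩ := exists_forall_exists_of_card_mul_pow_lt_one (κ := Fin (26 * n))
    (fun q hq => one_div_fifteen_le_dens_randomCoord_sub_sq (κ := Fin 32) hn hP (by simp)
      (mem_filter.1 hq).2)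
    (by simpa only [Fintype.card_fin] using card_pairs_mul_pow_lt_one hn hP)
  let F : P → Fin (26 * n) → ℝ := fun x k => randomCoord (p k).1 (p k).2 x
  have hF : LipschitzWith (32 * n) F := .of_dist_le_mul fun x y =>
    (dist_pi_le_iff (by positivity)).2 fun k => by
      simpa [mul_comm] using (lipschitzWith_randomCoord (p k).1 (p k).2).dist_le_mul x y
  refine ⟨F, hF, .of_le_mul_dist fun x y => ?_⟩
  rcases (dist_nonneg (x := x) (y := y)).eq_or_lt with hxy | hxy
  · rw [← hxy]
    positivity
  obtain ⟨k, hk⟩ := hp (x, y) (mem_filter.2 ⟨mem_univ _, hxy⟩)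
  rw [div_le_iff₀ (by positivity)] at hk
  have hcoord : dist x y ≤ 4 * √n * dist (F x k) (F y k) := by
    rw [← sq_le_sq₀ (by positivity) (by positivity), mul_pow, mul_pow, Real.dist_eq, sq_abs,
      Real.sq_sqrt n.cast_nonneg]
    linarith
  exact hcoord.trans (by push_cast; gcongr; exact dist_le_pi_dist (F x) (F y) k)

lemma antilipschitzWith_const_smul {E F : Type*} [PseudoMetricSpace E] [SeminormedAddCommGroup F]
    [NormedSpace ℝ F] {f : E → F} {L c : ℝ≥0} (hf : AntilipschitzWith L f) (hc : 0 < c) :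
    AntilipschitzWith (L * c⁻¹) fun x => (c : ℝ) • f x := by
  refine AntilipschitzWith.of_le_mul_nndist fun x y => (hf.le_mul_nndist x y).trans_eq ?_
  rw [nndist_smul₀, NNReal.nnnorm_eq, mul_assoc]
  congr 1
  exact (inv_mul_cancel_left₀ hc.ne' _).symm

lemma exists_lipschitzWith_antilipschitzWith_rpow {P : Type*} [PseudoMetricSpace P] {n : ℕ}
    (hn : 1 ≤ n) (hP : ENat.card P ≤ 2 ^ n) :
    ∃ F : P → Fin (26 * n) → ℝ, LipschitzWith (32 * (n : ℝ≥0) ^ (3 / 4 : ℝ)) F ∧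
      AntilipschitzWith (4 * (n : ℝ≥0) ^ (3 / 4 : ℝ)) F := by
  have : Finite P := ENat.card_lt_top.1 (hP.trans_lt (mod_cast ENat.natCast_lt_top (2 ^ n)))
  have := Fintype.ofFinite P
  rw [ENat.card_eq_coe_fintype_card] at hP
  obtain ⟨F, hlip, hanti⟩ := exists_lipschitzWith_antilipschitzWith_sqrt hn (mod_cast hP)
  have hn₀ : (n : ℝ≥0) ≠ 0 := by positivity
  set c : ℝ≥0 := (n : ℝ≥0) ^ (-(1 / 4) : ℝ) with hc
  have hup : ‖(c : ℝ)‖₊ * (32 * n) = 32 * (n : ℝ≥0) ^ (3 / 4 : ℝ) := by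
    rw [NNReal.nnnorm_eq, mul_left_comm]
    congr 1
    calc c * n = (n : ℝ≥0) ^ (-(1 / 4) + 1 : ℝ) := by rw [NNReal.rpow_add hn₀, NNReal.rpow_one]
      _ = (n : ℝ≥0) ^ (3 / 4 : ℝ) := by norm_num
  have hlow : 4 * NNReal.sqrt n * c⁻¹ = 4 * (n : ℝ≥0) ^ (3 / 4 : ℝ) := by
    rw [mul_assoc, NNReal.sqrt_eq_rpow, hc, ← NNReal.rpow_neg, ← NNReal.rpow_add hn₀]
    norm_num
  exact ⟨fun x => (c : ℝ) • F x, hup ▸ (lipschitzWith_smul (c : ℝ)).comp hlip,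
    hlow ▸ antilipschitzWith_const_smul hanti (by positivity)⟩

end Embedding

section Extension

/-- An injective metric space: every Lipschitz map into `X` from a subset of a metric space `Y`
extends to all of `Y` with the same constant. As a map on the subset is encoded by a map on `Y`,
the condition is vacuous for empty `X`. -/
def IsInjectiveMetricSpace.{u, v} (X : Type u) [PseudoMetricSpace X] : Prop :=
  ∀ ⦃Y : Type v⦄ [PseudoMetricSpace Y] (s : Set Y) (f : Y → X) (L : ℝ≥0), LipschitzOnWith L f s →
    ∃ g, LipschitzWith L g ∧ Set.EqOn f g s

variable {X : Type*}

lemma isInjectiveMetricSpace_of_isometryEquiv_lp_infty [PseudoMetricSpace X] {Γ : Type*}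
    (e : X ≃ᵢ lp (fun _ : Γ => ℝ) ∞) : IsInjectiveMetricSpace X := fun Y _ s f L hf => by
  obtain ⟨g, hg, hfg⟩ := (e.isometry.lipschitz.comp_lipschitzOnWith hf).extend_lp_infty
  refine ⟨e.symm ∘ g, by simpa using e.symm.isometry.lipschitz.comp hg, fun x hx => ?_⟩
  rw [Function.comp_apply, ← hfg hx, Function.comp_apply, e.symm_apply_apply]

lemma exists_lipschitzWith_leftInvOn.{u, v} {X : Type u} [MetricSpace X] [Nonempty X]
    (hX : IsInjectiveMetricSpace.{u, v} X) {ι : Type v} [Fintype ι] {S : Set X} {F : S → ι → ℝ}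
    {A B : ℝ≥0} (hF : LipschitzWith A F) (hF' : AntilipschitzWith B F) :
    ∃ (a : X → ι → ℝ) (M : (ι → ℝ) → X),
      LipschitzWith A a ∧ LipschitzWith B M ∧ Set.LeftInvOn M a S := by
  have hrestrict : ∀ x : S, Function.extend Subtype.val F 0 x = F x :=
    Subtype.val_injective.extend_apply F 0
  have hinv : ∀ x : S, Function.extend F Subtype.val (fun _ => Classical.arbitrary X) (F x) = x :=
    hF'.injective.extend_apply _ _
  have ha₀ : LipschitzOnWith A (Function.extend Subtype.val F 0) S := fun x hx y hy => by
    rw [hrestrict ⟨x, hx⟩, hrestrict ⟨y, hy⟩]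
    exact hF ⟨x, hx⟩ ⟨y, hy⟩
  have hM₀ : LipschitzOnWith B
      (Function.extend F Subtype.val fun _ => Classical.arbitrary X) (Set.range F) := by
    rintro _ ⟨x, rfl⟩ _ ⟨y, rfl⟩
    rw [hinv, hinv]
    exact hF' x y
  obtain ⟨a, ha, haF⟩ := ha₀.extend_pi
  obtain ⟨M, hM, hMF⟩ := hX _ _ _ hM₀
  refine ⟨a, M, ha, hM, fun x hx => ?_⟩
  rw [← haF hx, hrestrict ⟨x, hx⟩, ← hMF ⟨_, rfl⟩, hinv]

lemma dist_apply_le_of_isFixedPt [PseudoMetricSpace X] {g : X → X} {L : ℝ≥0} {c : X}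
    (hg : LipschitzWith L g) (hc : Function.IsFixedPt g c) (x : X) :
    dist x (g x) ≤ (1 + L) * dist x c := by
  have hgx : dist (g x) c ≤ L * dist x c := by simpa only [hc.eq] using hg.dist_le_mul x c
  linarith [dist_triangle_right x (g x) c]

end Extension

section Nets

open Metric

variable {X : Type*} {K : Set X} {n : ℕ}

lemma encard_le_of_forall_externalCoveringNumber_le [EMetricSpace X] {N : ℕ∞}
    (h : ∀ ε : ℝ≥0, 0 < ε → externalCoveringNumber ε K ≤ N) : K.encard ≤ N := by
  by_contra! hlt
  obtain ⟨T, hTK, hT⟩ := Set.exists_subset_encard_eq (Order.add_one_le_of_lt hlt)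
  have hTfin : T.Finite := Set.encard_ne_top_iff.1 (by simp [hT, hlt.ne_top])
  obtain ⟨ε, hε, hεT⟩ := ENNReal.exists_nnreal_pos_mul_lt (a := 2) (by simp)
    hTfin.einfsep_pos.ne'
  have hsep : IsSeparated (2 * ε : ℝ≥0) T := fun x hx y hy hxy =>
    lt_of_lt_of_le (by simpa [mul_comm] using hεT) (Set.einfsep_le_edist_of_mem hx hy hxy)
  refine (ENat.add_one_le_iff hlt.ne_top).1 ?_ |>.false
  calc N + 1 = T.encard := hT.symm
    _ ≤ packingNumber (2 * ε) K := hsep.encard_le_packingNumber hTK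
    _ ≤ externalCoveringNumber ε K := packingNumber_two_mul_le_externalCoveringNumber ε K
    _ ≤ N := h ε hε

lemma entropyNumber_nonneg [PseudoMetricSpace X] : 0 ≤ entropyNumber n K :=
  Real.sInf_nonneg fun _ hε => hε.1.le

lemma exists_isCover_of_entropyNumber_lt [PseudoMetricSpace X] (hK : Bornology.IsBounded K)
    {ε : ℝ≥0} (hε : entropyNumber n K < ε) : ∃ S : Set X, S.encard ≤ 2 ^ n ∧ IsCover ε K S := by
  rcases K.eq_empty_or_nonempty with rfl | ⟨x₀, -⟩
  · exact ⟨∅, by simp, by simp⟩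
  obtain ⟨ρ, hρ, hKρ⟩ := hK.subset_closedBall_lt 0 x₀
  have hne : {δ : ℝ | 0 < δ ∧ ∃ c : Fin (2 ^ n) → X, K ⊆ ⋃ i, closedBall (c i) δ}.Nonempty :=
    ⟨ρ, hρ, fun _ => x₀, hKρ.trans (Set.subset_iUnion (fun _ => closedBall x₀ ρ) 0)⟩
  obtain ⟨δ, ⟨-, c, hc⟩, hδε⟩ := exists_lt_of_csInf_lt hne hε
  refine ⟨Set.range c, ?_, ?_⟩
  · simpa using Set.encard_image_le c Set.univ
  · refine isCover_iff_subset_iUnion_closedBall.2 (hc.trans ?_)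
    rw [Set.biUnion_range]
    exact Set.iUnion_mono fun i => closedBall_subset_closedBall hδε.le

lemma exists_isCover_two_mul_entropyNumber [MetricSpace X] (hK : Bornology.IsBounded K) :
    ∃ S : Set X, S.encard ≤ 2 ^ n ∧ IsCover (2 * entropyNumber n K).toNNReal K S := by
  rcases (entropyNumber_nonneg (n := n) (K := K)).eq_or_lt with hzero | hpos
  · refine ⟨K, encard_le_of_forall_externalCoveringNumber_le fun ε hε => ?_, .rfl⟩
    have hlt : entropyNumber n K < ε := by rwa [← hzero, NNReal.coe_pos]
    obtain ⟨S, hS, hcover⟩ := exists_isCover_of_entropyNumber_lt hK hlt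
    exact hcover.externalCoveringNumber_le_encard.trans hS
  · refine exists_isCover_of_entropyNumber_lt hK ?_
    rw [Real.coe_toNNReal _ (by positivity)]
    linarith

end Nets

theorem lemma5p3_general :
    ∃ C : ℝ≥0, 0 < C ∧
      ∀ (X : Type*) [MetricSpace X] [Nonempty X], IsInjectiveMetricSpace.{_, 0} X →
        ∀ K : Set X, Bornology.IsBounded K →
          ∀ n : ℕ, 1 ≤ n →
            ∃ (a : X → (Fin (26 * n) → ℝ)) (M : (Fin (26 * n) → ℝ) → X),
              LipschitzWith (C * (n : ℝ≥0) ^ (3 / 4 : ℝ)) a ∧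
              LipschitzWith (C * (n : ℝ≥0) ^ (3 / 4 : ℝ)) M ∧
              ∀ f ∈ K, dist f (M (a f)) ≤ C * (n : ℝ) ^ (3 / 2 : ℝ) * entropyNumber n K := by
  refine ⟨258, by norm_num, fun X _ _ hX K hK n hn => ?_⟩
  obtain ⟨S, hS, hcover⟩ := exists_isCover_two_mul_entropyNumber (n := n) hK
  obtain ⟨F, hF, hF'⟩ := exists_lipschitzWith_antilipschitzWith_rpow hn
    ((ENat.card_coe_set_eq S).trans_le hS)
  obtain ⟨a, M, ha, hM, hMa⟩ := exists_lipschitzWith_leftInvOn hX hF hF'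
  refine ⟨a, M, ha.weaken (by gcongr; norm_num), hM.weaken (by gcongr; norm_num), fun f hf => ?_⟩
  obtain ⟨c, hc, hfc⟩ : ∃ c ∈ S, dist f c ≤ 2 * entropyNumber n K := by
    simpa [entropyNumber_nonneg] using hcover.subset_iUnion_closedBall hf
  have hone : (1 : ℝ) ≤ (n : ℝ) ^ (3 / 2 : ℝ) := Real.one_le_rpow (mod_cast hn) (by norm_num)
  have hpow : (n : ℝ) ^ (3 / 4 : ℝ) * (n : ℝ) ^ (3 / 4 : ℝ) = (n : ℝ) ^ (3 / 2 : ℝ) := by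
    rw [← Real.rpow_add (by positivity)]
    norm_num
  have hLip : (1 : ℝ) + ↑(4 * (n : ℝ≥0) ^ (3 / 4 : ℝ) * (32 * (n : ℝ≥0) ^ (3 / 4 : ℝ))) ≤
      129 * (n : ℝ) ^ (3 / 2 : ℝ) := by
    push_cast
    linarith
  calc dist f (M (a f)) ≤ _ * dist f c := dist_apply_le_of_isFixedPt (hM.comp ha) (hMa hc) f
    _ ≤ 129 * (n : ℝ) ^ (3 / 2 : ℝ) * (2 * entropyNumber n K) := by gcongr
    _ = (258 : ℝ≥0) * (n : ℝ) ^ (3 / 2 : ℝ) * entropyNumber n K := by push_cast; ring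

theorem lemma5p3 :
    ∃ C : ℝ≥0, 0 < C ∧
      ∀ (X : Type*) [NormedAddCommGroup X] [NormedSpace ℝ X] [CompleteSpace X] (Γ : Type*),
        Nonempty (X ≃ᵢ lp (fun _ : Γ => ℝ) ∞) →
        ∀ K : Set X, IsCompact K →
          ∀ n : ℕ, 1 ≤ n →
            ∃ (a : X → (Fin (26 * n) → ℝ)) (M : (Fin (26 * n) → ℝ) → X),
              LipschitzWith (C * (n : ℝ≥0) ^ (3 / 4 : ℝ)) a ∧
              LipschitzWith (C * (n : ℝ≥0) ^ (3 / 4 : ℝ)) M ∧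
              ∀ f ∈ K, ‖f - M (a f)‖ ≤ (C : ℝ) * (n : ℝ) ^ (3 / 2 : ℝ) * entropyNumber n K := by
  obtain ⟨C, hC, h⟩ := lemma5p3_general
  refine ⟨C, hC, fun X _ _ _ Γ ⟨e⟩ K hK n hn => ?_⟩
  simpa only [dist_eq_norm] using
    h X (isInjectiveMetricSpace_of_isometryEquiv_lp_infty e) K hK.isBounded n hn
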